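/- Let $(X,g)$ be a smooth ($C^\infty$) Riemannian manifold of dimension $n\ge 1$ that is complete, simply connected and has no conjugate points. For a unit tangent vector $v$ let $c_v:\mathbb R\to X$ be the geodesic with $\dot c_v(0)=v$, let $N_t(c_v)\subset T_{c_v(t)}X$ be the orthogonal complement of $\dot c_v(t)$, and let $A_v(t)\in\operatorname{End}(N_t(c_v))$ be the Jacobi tensor along $c_v$ with $A_v(0)=0$ and $A_v'(0)=\mathrm{id}$, that is, the solution with these initial values of $A_v''(t)+R(t)A_v(t)=0$, where $R(t)w=R(w,\dot c_v(t))\dot c_v(t)$ and derivatives are covariant derivatives along $c_v$. Suppose that $X$ is a harmonic manifold, i.e. that $\det A_v(t)$ does not depend on the unit tangent vector $v$, and let $f:\mathbb R\to\mathbb R$, $f(t)=\det A_v(t)$, be its density function. Then $f$ is an exponential polynomial: there are $k\in\mathbb N$, real polynomials $p_1,\dots,p_k,q_1,\dots,q_k$ and real numbers $\alpha_1,\dots,\alpha_k,\beta_1,\dots,\beta_k$ with $$f(t)=\sum_{i=1}^k\bigl(p_i(t)\sin(\beta_i t)+q_i(t)\cos(\beta_i t)\bigr)e^{\alpha_i t}\qquad\text{for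 all } t\in\mathbb R .$$ -/

import Mathlib

open scoped Manifold
open scoped ContDiff

noncomputable section HarmonicManifolds

namespace HarmonicManifold

variable {E : Type*} [NormedAddCommGroup E] [NormedSpace ℝ E]

/-! ### Christoffel symbols and curvature of a metric given in coordinates -/

/-- The Christoffel symbol of the first kind of a metric `g` on (an open subset of) `E`, as a linear
form in `z`: `(D_v g (w, z) + D_w g (v, z) - D_z g (v, w)) / 2`. -/
def christoffelFirst (g : E → E →L[ℝ] E →L[ℝ] ℝ) (y v w : E) : E →L[ℝ] ℝ :=
  let dg : E →L[ℝ] E →L[ℝ] E →L[ℝ] ℝ := fderiv ℝ g y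
  (1 / 2 : ℝ) • (dg v w + dg w v - (dg.flip v).flip w)

/-- The Christoffel symbol `Γ(v, w)` at `y` of the Levi-Civita connection of a metric `g` on (an
open subset of) `E`: the vector with `g (Γ(v, w), z) = christoffelFirst g y v w z` for all `z`. -/
def christoffel (g : E → E →L[ℝ] E →L[ℝ] ℝ) (y v w : E) : E :=
  (g y).inverse (christoffelFirst g y v w)

/-- The Riemann curvature tensor `R(v, w) z` at `y` of a metric `g` on (an open subset of) `E`, with
the sign convention `R(X, Y) Z = ∇_X ∇_Y Z - ∇_Y ∇_X Z - ∇_[X, Y] Z`. -/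
def coordCurvature (g : E → E →L[ℝ] E →L[ℝ] ℝ) (y v w z : E) : E :=
  fderiv ℝ (fun x => christoffel g x w z) y v - fderiv ℝ (fun x => christoffel g x v z) y w
    + christoffel g y v (christoffel g y w z) - christoffel g y w (christoffel g y v z)

section

open Bundle

variable {M : Type*} [TopologicalSpace M] [ChartedSpace E M] [IsManifold 𝓘(ℝ, E) ∞ M]
  [RiemannianBundle (fun x : M => TangentSpace 𝓘(ℝ, E) x)]

/-! ### Metric and curvature in the preferred charts

The fibre `TangentSpace 𝓘(ℝ, E) p` of the tangent bundle is a copy of `E`, a vector being identified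
with its coordinates in the preferred chart at `p`; `tangentCoordChange 𝓘(ℝ, E) p q x` converts
the coordinates of a vector at `x` from the preferred chart at `p` to the one at `q`. -/

/-- The Riemannian metric in the preferred chart at `p`, as a function of the coordinates `y`:
`(v, w) ↦ ⟨v, w⟩` at the point with coordinates `y`. -/
def chartMetric (p : M) (y : E) : E →L[ℝ] E →L[ℝ] ℝ :=
  let q : M := (extChartAt 𝓘(ℝ, E) p).symm y
  let L : E →L[ℝ] TangentSpace 𝓘(ℝ, E) q := tangentCoordChange 𝓘(ℝ, E) p q q
  (innerSL ℝ (E := TangentSpace 𝓘(ℝ, E) q)).bilinearComp L L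

/-- The Riemann curvature tensor `R(v, w) z` at `p`. -/
def curvature (p : M) (v w z : TangentSpace 𝓘(ℝ, E) p) : TangentSpace 𝓘(ℝ, E) p :=
  coordCurvature (E := E) (chartMetric p) (extChartAt 𝓘(ℝ, E) p p) v w z

/-! ### Curves, geodesics and Jacobi fields -/

/-- The velocity `ċ(t)` of a curve. -/
def velocity (c : ℝ → M) (t : ℝ) : TangentSpace 𝓘(ℝ, E) (c t) :=
  mfderiv 𝓘(ℝ, ℝ) 𝓘(ℝ, E) c t (1 : ℝ)

/-- Smoothness of a vector field along a curve, as a map to the tangent bundle. -/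
def IsSmoothAlong (c : ℝ → M) (V : ∀ t, TangentSpace 𝓘(ℝ, E) (c t)) : Prop :=
  ContMDiff 𝓘(ℝ, ℝ) 𝓘(ℝ, E).tangent ∞ (fun t => (⟨c t, V t⟩ : TangentBundle 𝓘(ℝ, E) M))

/-- The covariant derivative `DV/dt` of a vector field `V` along a curve `c`: in the coordinates
of the preferred chart at `c t` it is `V' + Γ(ċ, V)`. -/
def covDeriv (c : ℝ → M) (V : ∀ t, TangentSpace 𝓘(ℝ, E) (c t)) (t : ℝ) :
    TangentSpace 𝓘(ℝ, E) (c t) :=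
  (deriv (fun s => (tangentCoordChange 𝓘(ℝ, E) (c s) (c t) (c s) (V s) : E)) t
    + christoffel (chartMetric (c t)) (extChartAt 𝓘(ℝ, E) (c t) (c t)) (velocity c t) (V t) : E)

variable (E) in
/-- Geodesics `c : ℝ → M`. -/
def IsGeodesic (c : ℝ → M) : Prop :=
  ContMDiff 𝓘(ℝ, ℝ) 𝓘(ℝ, E) ∞ c ∧ ∀ t, covDeriv (E := E) c (velocity c) t = 0

variable (E) in
/-- Unit speed geodesics `c : ℝ → M`. -/
def IsUnitSpeedGeodesic (c : ℝ → M) : Prop :=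
  IsGeodesic E c ∧ ∀ t, ‖(velocity c t : TangentSpace 𝓘(ℝ, E) (c t))‖ = 1

/-- Parallel vector fields along a curve. -/
def IsParallelAlong (c : ℝ → M) (V : ∀ t, TangentSpace 𝓘(ℝ, E) (c t)) : Prop :=
  IsSmoothAlong c V ∧ ∀ t, covDeriv c V t = 0

/-- Jacobi fields along a curve (a geodesic in all uses): `J'' + R(J, ċ) ċ = 0`. -/
def IsJacobiField (c : ℝ → M) (J : ∀ t, TangentSpace 𝓘(ℝ, E) (c t)) : Prop :=
  IsSmoothAlong c J ∧
    ∀ t, covDeriv c (covDeriv c J) t + curvature (c t) (J t) (velocity c t) (velocity c t) = 0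

variable (E M) in
/-- Geodesic completeness: for every tangent vector `v` there is a geodesic `c : ℝ → M`, defined
for all times, with `ċ(0) = v`. -/
def IsGeodesicallyComplete : Prop :=
  ∀ (p : M) (v : TangentSpace 𝓘(ℝ, E) p), ∃ c : ℝ → M, IsGeodesic E c ∧
    (⟨c 0, velocity c 0⟩ : TangentBundle 𝓘(ℝ, E) M) = ⟨p, v⟩

variable (E M) in
/-- Absence of conjugate points: a Jacobi field along a unit speed geodesic that vanishes at two
different times vanishes identically. -/
def HasNoConjugatePoints : Prop :=
  ∀ c : ℝ → M, IsUnitSpeedGeodesic E c → ∀ J : ∀ t, TangentSpace 𝓘(ℝ, E) (c t),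
    IsJacobiField c J → ∀ a b : ℝ, a ≠ b → J a = 0 → J b = 0 → ∀ t, J t = 0

/-! ### Jacobi tensors and harmonic manifolds -/

variable (E) in
/-- The fibre `N_t(c)` of the normal bundle of `c`. -/
def normalSpace (c : ℝ → M) (t : ℝ) : Submodule ℝ (TangentSpace 𝓘(ℝ, E) (c t)) :=
  (Submodule.span ℝ {(velocity c t : TangentSpace 𝓘(ℝ, E) (c t))})ᗮ

/-- `e` is a parallel orthonormal frame of the normal bundle of `c`. -/
def IsParallelNormalFrame (c : ℝ → M)
    (e : Fin (Module.finrank ℝ E - 1) → ∀ t, normalSpace E c t) : Prop :=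
  (∀ t, Orthonormal ℝ (fun i => e i t)) ∧
    ∀ i, IsParallelAlong c (fun t => (e i t : TangentSpace 𝓘(ℝ, E) (c t)))

/-- `A` is the Jacobi tensor `A_v` along the unit speed geodesic `c = c_v`, that is, the section `A`
of `End (N(c))` with `A'' + R A = 0`, `A(0) = 0` and `A'(0) = id`. The derivative of a section `Y`
of `End (N(c))` is determined by `Y' x = D(Y x)/dt` for parallel sections `x` of `N(c)`; by
linearity it is enough to let `x` run through a parallel orthonormal frame (and the choice of the
frame is irrelevant). -/
def IsJacobiTensorA (c : ℝ → M) (A : ∀ t, normalSpace E c t →ₗ[ℝ] normalSpace E c t) : Prop :=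
  A 0 = 0 ∧
  ∃ e : Fin (Module.finrank ℝ E - 1) → ∀ t, normalSpace E c t, IsParallelNormalFrame c e ∧
    ∀ i, IsJacobiField c (fun t => (A t (e i t) : TangentSpace 𝓘(ℝ, E) (c t))) ∧
      covDeriv c (fun t => (A t (e i t) : TangentSpace 𝓘(ℝ, E) (c t))) 0 = e i 0

variable (E M) in
/-- `f` is the density function of `M`: for every unit speed geodesic `c = c_v`, the Jacobi tensor
`A_v` satisfies `f(t) = det A_v(t)` for all `t`. -/
def IsDensityFunction (f : ℝ → ℝ) : Prop :=
  ∀ c : ℝ → M, IsUnitSpeedGeodesic E c →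
    ∃ A : ∀ t, normalSpace E c t →ₗ[ℝ] normalSpace E c t,
      IsJacobiTensorA c A ∧ ∀ t, f t = LinearMap.det (A t)

variable (E M) in
/-- Harmonic manifolds: complete, simply connected Riemannian manifolds without conjugate points
whose volume density `det A_v(t)` does not depend on the unit tangent vector `v`. -/
structure IsHarmonicManifold : Prop where
  complete : IsGeodesicallyComplete E M
  simplyConnected : SimplyConnectedSpace M
  noConjugatePoints : HasNoConjugatePoints E M
  radialDensity : ∃ f : ℝ → ℝ, IsDensityFunction E M f

end

end HarmonicManifold

/-- Exponential polynomials: finite sums of terms `(p(t) sin(β t) + q(t) cos(β t)) exp(α t)` with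
real polynomials `p`, `q` and real numbers `α`, `β`. -/
def IsExponentialPolynomial (f : ℝ → ℝ) : Prop :=
  ∃ (k : ℕ) (p q : Fin k → Polynomial ℝ) (α β : Fin k → ℝ), ∀ t : ℝ,
    f t = ∑ i, ((p i).eval t * Real.sin (β i * t) + (q i).eval t * Real.cos (β i * t))
      * Real.exp (α i * t)

end HarmonicManifolds

/-! Fix one unit speed geodesic `c`. Each shifted curve `c(· + s)` is again a unit speed geodesic,
so the same `f` is the determinant of its Jacobi tensor; thus `f(t - s)` is, as a function of `t`,
the determinant of a Jacobi tensor along `c` itself that vanishes at time `s`. In a parallel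
orthonormal normal frame of `c` (with `m = n - 1` members) this is a constant times the determinant
of `m` solutions of one fixed equation `y'' + R y = 0`, whose solution space is finite-dimensional.
Expanding each row in a basis of solutions puts all translates of `f` in the span of the finitely
many determinants of basis solutions (`isExponentialPolynomial_of_det`).

A differentiable function whose translates span a finite-dimensional space is an exponential
polynomial: the span is closed under limits of difference quotients, hence stable under `d/dt`, and
splitting it over ℂ into generalized eigenspaces gives polynomials times exponentials
(`isExponentialPolynomial_of_translates`).

The geometric input is metric compatibility of the connection, linearity of `R(·, ċ)ċ`, and the
reduction `IsJacobiTensorA.exists_det_eq`. Continuity of `R`, needed for uniqueness of solutions, is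
recovered from the solutions themselves. -/

/-! ### Exponential polynomials and spaces of translates -/

open Polynomial in
theorem Polynomial.exists_derivative_eq {K : Type*} [Field K] [CharZero K] (p : K[X]) :
    ∃ q : K[X], derivative q = p := by
  induction p using Polynomial.induction_on' with
  | add p q hp hq =>
    obtain ⟨p', rfl⟩ := hp
    obtain ⟨q', rfl⟩ := hq
    exact ⟨p' + q', derivative_add⟩
  | monomial n a =>
    refine ⟨monomial (n + 1) (a / (n + 1)), ?_⟩
    rw [derivative_monomial]
    have : (n : K) + 1 ≠ 0 := by exact_mod_cast n.succ_ne_zero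
    simp [this]

/-- A function annihilated by a power of `d/dt - μ` is a polynomial times `exp (μ t)`. -/
theorem exists_polynomial_mul_exp {V : Submodule ℂ (ℝ → ℂ)} {D : Module.End ℂ V}
    (hD : ∀ (g : V) (t : ℝ), HasDerivAt (g : ℝ → ℂ) ((D g : ℝ → ℂ) t) t) (μ : ℂ) (k : ℕ) (g : V)
    (hg : ((D - algebraMap ℂ _ μ) ^ k) g = 0) :
    ∃ P : Polynomial ℂ, ∀ t : ℝ, (g : ℝ → ℂ) t = P.eval (t : ℂ) * Complex.exp (μ * t) := by
  induction k generalizing g with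
  | zero =>
    have hg0 : g = 0 := by simpa using hg
    exact ⟨0, fun t => by simp [hg0]⟩
  | succ k ih =>
    -- The induction hypothesis is applied to `(D - μ) g`, which is therefore `P(t) exp(μt)`. With
    -- the integrating factor `exp(-μt)`, the function `g exp(-μt)` has derivative `P`, so it
    -- differs from an antiderivative `Q` by a constant.
    rw [pow_succ] at hg
    obtain ⟨P, hP⟩ := ih _ hg
    obtain ⟨Q, hQ⟩ := P.exists_derivative_eq
    have hder : ∀ t : ℝ, HasDerivAt
        (fun s : ℝ => (g : ℝ → ℂ) s * Complex.exp (-(μ * s)) - Q.eval (s : ℂ)) 0 t := by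
      intro t
      have h1 : HasDerivAt (fun s : ℝ => Complex.exp (-(μ * s)))
          (Complex.exp (-(μ * t)) * -(μ * 1)) t :=
        (((Complex.ofRealCLM.hasDerivAt (x := t)).const_mul μ).neg).cexp
      have h2 : HasDerivAt (fun s : ℝ => Q.eval (s : ℂ)) (P.eval (t : ℂ)) t := by
        have := (Q.hasDerivAt (t : ℂ)).comp_ofReal
        rwa [hQ] at this
      refine (((hD g t).mul h1).sub h2).congr_deriv ?_
      have h3 := hP t
      have h4 : ((D - algebraMap ℂ (Module.End ℂ V) μ) g : V) = D g - μ • g := rfl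
      rw [h4] at h3
      have h5 : (D g : ℝ → ℂ) t - μ * (g : ℝ → ℂ) t = P.eval (t : ℂ) * Complex.exp (μ * t) := h3
      have h6 : Complex.exp (μ * t) * Complex.exp (-(μ * t)) = 1 := by
        rw [← Complex.exp_add]; simp
      linear_combination Complex.exp (-(μ * t)) * h5 + P.eval (t : ℂ) * h6
    have hconst := is_const_of_deriv_eq_zero (fun t => (hder t).differentiableAt)
      (fun t => (hder t).deriv)
    refine ⟨Q + Polynomial.C ((g : ℝ → ℂ) 0 * Complex.exp (-(μ * (0 : ℝ))) - Q.eval ((0 : ℝ) : ℂ)),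
      fun t => ?_⟩
    have h6 : Complex.exp (μ * t) * Complex.exp (-(μ * t)) = 1 := by
      rw [← Complex.exp_add]; simp
    have h7 := hconst t 0
    rw [Polynomial.eval_add, Polynomial.eval_C, ← h7]
    linear_combination (-(g : ℝ → ℂ) t) * h6

namespace IsExponentialPolynomial

theorem zero : IsExponentialPolynomial fun _ => 0 :=
  ⟨0, 0, 0, 0, 0, fun t => by simp⟩

theorem add {f g : ℝ → ℝ} (hf : IsExponentialPolynomial f) (hg : IsExponentialPolynomial g) :
    IsExponentialPolynomial fun t => f t + g t := by
  obtain ⟨k, p, q, α, β, hf⟩ := hf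
  obtain ⟨l, p', q', α', β', hg⟩ := hg
  refine ⟨k + l, Fin.append p p', Fin.append q q', Fin.append α α', Fin.append β β', fun t => ?_⟩
  beta_reduce
  rw [Fin.sum_univ_add, hf, hg]
  simp

theorem re_polynomial_mul_exp (P : Polynomial ℂ) (μ : ℂ) :
    IsExponentialPolynomial fun t => (P.eval (t : ℂ) * Complex.exp (μ * t)).re := by
  induction P using Polynomial.induction_on' with
  | add p q hp hq => simpa [add_mul] using hp.add hq
  | monomial n a =>
    -- With `μ = α + iβ`, `Re (a tⁿ exp(μt)) = tⁿ (Re a cos βt - Im a sin βt) exp(αt)`.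
    refine ⟨1, fun _ => Polynomial.monomial n (-a.im), fun _ => Polynomial.monomial n a.re,
      fun _ => μ.re, fun _ => μ.im, fun t => ?_⟩
    have h1 : (μ * t).re = μ.re * t := by simp
    have h2 : (μ * t).im = μ.im * t := by simp
    have h3 : (a * (t : ℂ) ^ n).re = a.re * t ^ n := by
      rw [← Complex.ofReal_pow, Complex.re_mul_ofReal]
    have h4 : (a * (t : ℂ) ^ n).im = a.im * t ^ n := by
      rw [← Complex.ofReal_pow, Complex.im_mul_ofReal]
    simp only [Polynomial.eval_monomial, Complex.mul_re, Complex.exp_re, Complex.exp_im, h1, h2,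
      Finset.univ_unique, Finset.sum_singleton]
    rw [← Complex.mul_re, h3, h4]
    ring

end IsExponentialPolynomial

/-- A differentiable function whose translates lie in a finite-dimensional space is an
exponential polynomial. -/
theorem isExponentialPolynomial_of_translates {f : ℝ → ℝ} (hf : Differentiable ℝ f)
    (W : Submodule ℝ (ℝ → ℝ)) [FiniteDimensional ℝ W] (hW : ∀ s, (fun t => f (t - s)) ∈ W) :
    IsExponentialPolynomial f := by
  let F : ℝ → ℝ → ℂ := fun s t => (f (t - s) : ℂ)
  let V : Submodule ℂ (ℝ → ℂ) := Submodule.span ℂ (Set.range F)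
  have hFV : ∀ s, F s ∈ V := fun s => Submodule.subset_span ⟨s, rfl⟩
  have hfin : FiniteDimensional ℂ V := by
    let ι : (ℝ → ℝ) →ₗ[ℝ] (ℝ → ℂ) := Complex.ofRealCLM.toLinearMap.compLeft ℝ
    let b := Module.finBasis ℝ W
    -- The real coefficients expressing a translate in a basis of `W` also serve over ℂ.
    have hle : V ≤ Submodule.span ℂ (Set.range fun i => ι (b i)) := by
      rw [Submodule.span_le]
      rintro _ ⟨s, rfl⟩
      have h1 := congrArg (fun w : W => ι w) (b.sum_repr ⟨_, hW s⟩)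
      have h2 : F s = ∑ i, ((b.repr ⟨_, hW s⟩ i : ℝ) : ℂ) • ι (b i) := by
        refine Eq.trans (Eq.symm h1) ?_
        simp only [Submodule.coe_sum, map_sum, Submodule.coe_smul, map_smul]
        rfl
      rw [h2]
      exact Submodule.sum_mem _ fun i _ => Submodule.smul_mem _ _ (Submodule.subset_span ⟨i, rfl⟩)
    have : FiniteDimensional ℂ (Submodule.span ℂ (Set.range fun i => ι (b i))) :=
      FiniteDimensional.span_of_finite ℂ (Set.finite_range _)
    exact Submodule.finiteDimensional_of_le hle
  have hdiff : ∀ g ∈ V, Differentiable ℝ g := by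
    intro g hg
    induction hg using Submodule.span_induction with
    | mem x hx =>
      obtain ⟨s, rfl⟩ := hx
      exact Complex.ofRealCLM.differentiable.comp (hf.comp (differentiable_id.sub_const s))
    | zero => exact differentiable_const 0
    | add x y _ _ hx hy => exact hx.add hy
    | smul a x _ hx => exact hx.const_smul a
  have htrans : ∀ g ∈ V, ∀ h : ℝ, (fun t => g (t + h)) ∈ V := by
    intro g hg h
    induction hg using Submodule.span_induction with
    | mem x hx =>
      obtain ⟨s, rfl⟩ := hx
      convert hFV (s - h) using 1
      funext t
      simp only [F]
      congr 2
      ring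
    | zero => exact V.zero_mem
    | add x y _ _ hx hy => exact V.add_mem hx hy
    | smul a x _ hx => exact V.smul_mem a hx
  have hderiv : ∀ g ∈ V, deriv g ∈ V := by
    intro g hg
    -- In the topology of pointwise convergence the finite-dimensional `V` is closed, so it contains
    -- the limit of the difference quotients, which lie in `V` by translation invariance.
    have hclosed : IsClosed (V : Set (ℝ → ℂ)) := V.closed_of_finiteDimensional
    have hlim : Filter.Tendsto (fun (h : ℝ) (t : ℝ) => h⁻¹ • (g (t + h) - g t))
        (nhdsWithin 0 {0}ᶜ) (nhds (deriv g)) := by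
      rw [tendsto_pi_nhds]
      intro t
      exact ((hdiff g hg) t).hasDerivAt.tendsto_slope_zero
    refine hclosed.mem_of_tendsto hlim (Filter.Eventually.of_forall fun h => ?_)
    have := V.smul_mem ((h⁻¹ : ℝ) : ℂ) (V.sub_mem (htrans g hg h) hg)
    have heq : (fun t => h⁻¹ • (g (t + h) - g t)) =
        ((h⁻¹ : ℝ) : ℂ) • ((fun t => g (t + h)) - g) := by
      funext t
      simp
    rwa [← heq] at this
  let D : Module.End ℂ V :=
    { toFun := fun g => ⟨deriv g, hderiv g g.2⟩
      map_add' := fun g h => Subtype.ext <| funext fun t =>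
        deriv_add (hdiff g g.2 t) (hdiff h h.2 t)
      map_smul' := fun a g => Subtype.ext <| funext fun t =>
        deriv_const_smul a (hdiff g g.2 t) }
  have hD : ∀ (g : V) (t : ℝ), HasDerivAt (g : ℝ → ℂ) ((D g : ℝ → ℂ) t) t :=
    fun g t => (hdiff g g.2 t).hasDerivAt
  have key : ∀ g : V, IsExponentialPolynomial fun t => ((g : ℝ → ℂ) t).re := by
    intro g
    -- Over ℂ the generalized eigenspaces of `D` span `V`.
    have hg : g ∈ ⨆ μ : ℂ, D.maxGenEigenspace μ := by
      rw [Module.End.iSup_maxGenEigenspace_eq_top]; trivial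
    induction hg using Submodule.iSup_induction' with
    | mem μ g hg =>
      obtain ⟨k, hk⟩ := (Module.End.mem_maxGenEigenspace _ _ _).1 hg
      obtain ⟨P, hP⟩ := exists_polynomial_mul_exp hD μ k g hk
      simpa only [hP] using IsExponentialPolynomial.re_polynomial_mul_exp P μ
    | zero => simpa using IsExponentialPolynomial.zero
    | add x y _ _ hx hy => simpa using hx.add hy
  simpa [F] using key ⟨F 0, hFV 0⟩

/-! ### Second-order linear systems and determinants of solutions -/

section LinearODE

open Set Matrix

/-- The solutions `y : ℝ → ℝ^m` of the equation `y'' + R y = 0`. -/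
def linearODESolutions {m : ℕ} (R : ℝ → Matrix (Fin m) (Fin m) ℝ) :
    Submodule ℝ (ℝ → Fin m → ℝ) where
  carrier := {y | ∃ z : ℝ → Fin m → ℝ,
    (∀ t, HasDerivAt y (z t) t) ∧ ∀ t, HasDerivAt z (-(R t *ᵥ y t)) t}
  zero_mem' := ⟨0, fun t => hasDerivAt_const t 0, fun t =>
    (hasDerivAt_const t (0 : Fin m → ℝ)).congr_deriv (by simp)⟩
  add_mem' := by
    rintro y y' ⟨z, h1, h2⟩ ⟨z', h1', h2'⟩
    refine ⟨z + z', fun t => (h1 t).add (h1' t), fun t => ?_⟩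
    refine ((h2 t).add (h2' t)).congr_deriv ?_
    rw [Pi.add_apply, mulVec_add, neg_add]
  smul_mem' := by
    rintro a y ⟨z, h1, h2⟩
    refine ⟨a • z, fun t => (h1 t).const_smul a, fun t => ?_⟩
    refine ((h2 t).const_smul a).congr_deriv ?_
    rw [Pi.smul_apply, mulVec_smul, smul_neg]

/-- The pair `(y, y')` solves a first-order linear system whose operator is bounded on compact
intervals, hence uniformly Lipschitz there; uniqueness compares it with the zero solution. -/
theorem eq_zero_of_mem_linearODESolutions {m : ℕ} {R : ℝ → Matrix (Fin m) (Fin m) ℝ}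
    (hR : Continuous R) {y : ℝ → Fin m → ℝ} (hy : y ∈ linearODESolutions R)
    (h0 : y 0 = 0) (h1 : deriv y 0 = 0) : y = 0 := by
  obtain ⟨z, hz1, hz2⟩ := hy
  have hz0 : z 0 = 0 := by rw [← h1, (hz1 0).deriv]
  let L : ℝ → (Fin m → ℝ) × (Fin m → ℝ) →L[ℝ] (Fin m → ℝ) × (Fin m → ℝ) := fun t =>
    (ContinuousLinearMap.snd ℝ (Fin m → ℝ) (Fin m → ℝ)).prod
      (-((LinearMap.toContinuousLinearMap (Matrix.toLin' (R t))).comp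
        (ContinuousLinearMap.fst ℝ (Fin m → ℝ) (Fin m → ℝ))))
  have hL : Continuous L := by
    have h2 : Continuous fun t => LinearMap.toContinuousLinearMap (Matrix.toLin' (R t)) :=
      (LinearMap.continuous_of_finiteDimensional
        ((LinearMap.toContinuousLinearMap.toLinearMap).comp
          (Matrix.toLin' (R := ℝ) (m := Fin m) (n := Fin m)).toLinearMap)).comp hR
    have h3 : Continuous fun t => -((LinearMap.toContinuousLinearMap (Matrix.toLin' (R t))).comp
        (ContinuousLinearMap.fst ℝ (Fin m → ℝ) (Fin m → ℝ))) :=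
      (h2.clm_comp continuous_const).neg
    exact (ContinuousLinearMap.prodₗᵢ (𝕜 := ℝ) (E := (Fin m → ℝ) × (Fin m → ℝ))
      (F := Fin m → ℝ) (G := Fin m → ℝ) ℝ).continuous.comp (continuous_const.prodMk h3)
  funext T
  -- The margin 1 puts both `0` and `T` in the open interval.
  obtain ⟨C, hC⟩ := (isCompact_Icc (a := -(|T| + 1)) (b := |T| + 1)).exists_bound_of_continuousOn
    hL.continuousOn
  have hpos : (0 : ℝ) < |T| + 1 := by positivity
  have huniq := ODE_solution_unique_of_mem_Ioo (v := fun t x => L t x) (s := fun _ => univ)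
    (K := C.toNNReal) (f := fun t => (y t, z t)) (g := fun _ => 0) (t₀ := 0)
    (a := -(|T| + 1)) (b := |T| + 1)
    (fun t ht => ((L t).lipschitz.weaken
      (by
        rw [← NNReal.coe_le_coe, coe_nnnorm]
        exact (hC t (Ioo_subset_Icc_self ht)).trans (Real.le_coe_toNNReal C))).lipschitzOnWith)
    ⟨by linarith, hpos⟩
    (fun t _ => ⟨by simpa [L] using (hz1 t).prodMk (hz2 t), trivial⟩)
    (fun t _ => ⟨by simpa using hasDerivAt_const t (0 : (Fin m → ℝ) × (Fin m → ℝ)), trivial⟩)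
    (by simp [h0, hz0])
  have := huniq (show T ∈ Ioo (-(|T| + 1)) (|T| + 1) from
    ⟨by linarith [neg_abs_le T], by linarith [le_abs_self T]⟩)
  exact (Prod.ext_iff.1 this).1

/-- A solution is determined by `(y 0, y' 0)`; existence of solutions is not needed. -/
theorem finiteDimensional_linearODESolutions {m : ℕ} {R : ℝ → Matrix (Fin m) (Fin m) ℝ}
    (hR : Continuous R) : FiniteDimensional ℝ (linearODESolutions R) := by
  have hd : ∀ y : linearODESolutions R, DifferentiableAt ℝ (y : ℝ → Fin m → ℝ) 0 := by
    rintro ⟨y, z, h1, h2⟩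
    exact (h1 0).differentiableAt
  let Φ : linearODESolutions R →ₗ[ℝ] (Fin m → ℝ) × (Fin m → ℝ) :=
    { toFun := fun y => ((y : ℝ → Fin m → ℝ) 0, deriv (y : ℝ → Fin m → ℝ) 0)
      map_add' := fun y y' => Prod.ext rfl (deriv_add (hd y) (hd y'))
      map_smul' := fun a y => Prod.ext rfl (deriv_const_smul a (hd y)) }
  have hΦ : Function.Injective Φ := by
    rw [injective_iff_map_eq_zero]
    intro y hy
    obtain ⟨h1, h2⟩ := Prod.ext_iff.1 hy
    exact Subtype.ext (eq_zero_of_mem_linearODESolutions hR y.2 h1 h2)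
  exact Module.Finite.of_injective Φ hΦ

/-- The coefficient of a linear equation is continuous wherever a fundamental system of smooth
solutions exists. -/
theorem continuousAt_of_fundamentalSystem {m : ℕ} {R Y : ℝ → Matrix (Fin m) (Fin m) ℝ}
    (hY : ∀ i j, ContDiff ℝ ∞ fun t => Y t i j)
    (hode : ∀ i j t, deriv (deriv fun s => Y s i j) t + ∑ k, R t j k * Y t i k = 0)
    {t : ℝ} (ht : (Y t).det ≠ 0) : ContinuousAt R t := by
  let Z : ℝ → Matrix (Fin m) (Fin m) ℝ := fun t => of fun i j => deriv (deriv fun s => Y s i j) t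
  have hYc : Continuous Y := continuous_matrix fun i j => (hY i j).continuous
  have hZc : Continuous Z := continuous_matrix fun i j => by
    have := ((contDiff_infty_iff_deriv.1 (hY i j)).2)
    exact (contDiff_infty_iff_deriv.1 this).2.continuous
  -- The solutions are the rows of `Y`, so `Y'' = -Y Rᵀ`; where `Y` is invertible this gives `R =
  -- (-Y⁻¹ Y'')ᵀ`, with the inverse written through the adjugate.
  have hZ : ∀ t, Z t = -(Y t * (R t)ᵀ) := fun t => by
    ext i j
    refine (eq_neg_of_add_eq_zero_left (hode i j t)).trans ?_
    rw [neg_apply, mul_apply]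
    simp only [transpose_apply, mul_comm]
  have hev : ∀ᶠ s in nhds t, (-((Y s).det)⁻¹ • ((Y s).adjugate * Z s))ᵀ = R s := by
    filter_upwards [hYc.matrix_det.continuousAt.eventually_ne ht] with s hs
    rw [hZ, mul_neg, ← mul_assoc, adjugate_mul, smul_mul_assoc, one_mul, smul_neg, neg_smul,
      neg_neg, smul_smul, inv_mul_cancel₀ hs, one_smul, transpose_transpose]
  refine ContinuousAt.congr ?_ hev
  have hdet := (hYc.matrix_det.continuousAt (x := t)).inv₀ ht
  have h1 : ContinuousAt (fun s => -((Y s).det)⁻¹ • ((Y s).adjugate * Z s)) t :=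
    hdet.neg.smul (hYc.matrix_adjugate.mul hZc).continuousAt
  exact (Continuous.matrix_transpose continuous_id).continuousAt.comp h1

/-- A function that for every `s` is proportional to the determinant of solutions of the equation
`y'' + R(· + s) y = 0` is an exponential polynomial. -/
theorem isExponentialPolynomial_of_det {m : ℕ} (R : ℝ → Matrix (Fin m) (Fin m) ℝ) (f : ℝ → ℝ)
    (h : ∀ s : ℝ, ∃ (κ : ℝ) (Y : ℝ → Matrix (Fin m) (Fin m) ℝ),
      (∀ i j, ContDiff ℝ ∞ fun t => Y t i j) ∧
      (∀ i j t, deriv (deriv fun u => Y u i j) t + ∑ k, R (t + s) j k * Y t i k = 0) ∧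
      ∀ t, f t = κ * (Y t).det) :
    IsExponentialPolynomial f := by
  by_cases hf0 : ∀ t, f t = 0
  · exact (funext hf0 : f = fun _ => 0) ▸ IsExponentialPolynomial.zero
  push Not at hf0
  obtain ⟨t₁, ht₁⟩ := hf0
  choose κ Y hY hode hdet using h
  -- Shifting back by `s` turns every `Y s` into solutions of the same equation with coefficient
  -- `R`.
  let Y' : ℝ → ℝ → Matrix (Fin m) (Fin m) ℝ := fun s t => Y s (t - s)
  have hY' : ∀ s i j, ContDiff ℝ ∞ fun t => Y' s t i j := fun s i j =>
    (hY s i j).comp (contDiff_id.sub contDiff_const)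
  have hode' : ∀ s i j t, deriv (deriv fun u => Y' s u i j) t + ∑ k, R t j k * Y' s t i k = 0 := by
    intro s i j t
    have h1 : (deriv fun u => Y' s u i j) = fun u => deriv (fun u => Y s u i j) (u - s) :=
      funext fun u => deriv_comp_sub_const (f := fun u => Y s u i j) s u
    have h2 := deriv_comp_sub_const (f := deriv fun u => Y s u i j) s t
    have h3 := hode s i j (t - s)
    rw [sub_add_cancel] at h3
    rw [h1, h2]
    exact h3
  have hR : Continuous R := by
    rw [continuous_iff_continuousAt]
    intro t₀
    -- The shift `s = t₀ - t₁` moves `t₁`, where `f` and hence the determinant do not vanish, to the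
    -- given `t₀`.
    refine continuousAt_of_fundamentalSystem (hY' (t₀ - t₁)) (hode' (t₀ - t₁)) fun h => ht₁ ?_
    have : (Y (t₀ - t₁) t₁).det = 0 := by simpa [Y'] using h
    rw [hdet (t₀ - t₁), this, mul_zero]
  have := finiteDimensional_linearODESolutions hR
  have hmem : ∀ s i, (fun t => Y' s t i) ∈ linearODESolutions R := by
    intro s i
    have hc : ∀ j, ContDiff ℝ ∞ (deriv fun u => Y' s u i j) := fun j =>
      (contDiff_infty_iff_deriv.1 (hY' s i j)).2
    refine ⟨fun t j => deriv (fun u => Y' s u i j) t, fun t => ?_, fun t => ?_⟩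
    · exact hasDerivAt_pi.2 fun j =>
        ((hY' s i j).differentiable (by simp) t).hasDerivAt
    · refine hasDerivAt_pi.2 fun j => ?_
      refine (((hc j).differentiable (by simp) t).hasDerivAt).congr_deriv ?_
      exact eq_neg_of_add_eq_zero_left (hode' s i j t)
  have hfd : Differentiable ℝ f := by
    have hd : Differentiable ℝ fun t => (Y 0 t).det := by
      simp only [det_apply]
      exact Differentiable.fun_sum fun σ _ => Differentiable.const_smul
        (Differentiable.fun_finsetProd fun i _ => (hY 0 _ _).differentiable (by simp)) _
    rw [funext (hdet 0)]
    exact hd.const_mul _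
  let b := Module.finBasis ℝ (linearODESolutions R)
  -- The finite spanning family: determinants with rows chosen among the basis solutions,
  -- independent of `s`.
  let w : (Fin m → Fin (Module.finrank ℝ (linearODESolutions R))) → ℝ → ℝ := fun r t =>
    det (of fun i => (b (r i) : ℝ → Fin m → ℝ) t)
  have : FiniteDimensional ℝ (Submodule.span ℝ (range w)) :=
    FiniteDimensional.span_of_finite ℝ (finite_range w)
  refine isExponentialPolynomial_of_translates hfd (Submodule.span ℝ (range w)) fun s => ?_
  have hcomb : ∀ i t, Y' s t i = ∑ k, b.repr ⟨_, hmem s i⟩ k • (b k : ℝ → Fin m → ℝ) t := by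
    intro i t
    have h1 := congrArg (fun y : linearODESolutions R => (y : ℝ → Fin m → ℝ) t)
      (b.sum_repr ⟨_, hmem s i⟩)
    refine h1.symm.trans ?_
    simp only [Submodule.coe_sum, Finset.sum_apply, Submodule.coe_smul, Pi.smul_apply]
  have hsum : (fun t => f (t - s)) =
      κ s • ∑ r : Fin m → Fin (Module.finrank ℝ (linearODESolutions R)),
        (∏ i, b.repr ⟨_, hmem s i⟩ (r i)) • w r := by
    funext t
    have h1 : det (Y' s t) = ∑ r : Fin m → Fin (Module.finrank ℝ (linearODESolutions R)),
        (∏ i, b.repr ⟨_, hmem s i⟩ (r i)) • w r t := by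
      have h2 : Y' s t =
          fun i => ∑ k, b.repr ⟨_, hmem s i⟩ k • (b k : ℝ → Fin m → ℝ) t :=
        funext fun i => hcomb i t
      rw [h2]
      -- Multilinearity of the determinant in its rows.
      refine ((detRowAlternating (n := Fin m) (R := ℝ)).toMultilinearMap.map_sum _).trans ?_
      exact Finset.sum_congr rfl fun r _ =>
        (detRowAlternating (n := Fin m) (R := ℝ)).toMultilinearMap.map_smul_univ _ _
    rw [hdet s]
    change κ s * det (Y' s t) = _
    rw [h1]
    simp [Finset.sum_apply]
  rw [hsum]
  exact Submodule.smul_mem _ _ (Submodule.sum_mem _ fun r _ =>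
    Submodule.smul_mem _ _ (Submodule.subset_span ⟨r, rfl⟩))

end LinearODE

namespace HarmonicManifold

/-! ### Christoffel symbols and curvature in coordinates -/

section Coordinates

variable {E : Type*} [NormedAddCommGroup E] [NormedSpace ℝ E]

theorem christoffelFirst_apply (g : E → E →L[ℝ] E →L[ℝ] ℝ) (y v w z : E) :
    christoffelFirst g y v w z =
      1 / 2 * (fderiv ℝ g y v w z + fderiv ℝ g y w v z - fderiv ℝ g y z v w) :=
  rfl

theorem christoffel_add_left (g : E → E →L[ℝ] E →L[ℝ] ℝ) (y v v' w : E) :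
    christoffel g y (v + v') w = christoffel g y v w + christoffel g y v' w := by
  unfold christoffel
  rw [← map_add]
  congr 1
  ext z
  simp only [christoffelFirst_apply, add_apply, map_add]
  ring

theorem christoffel_smul_left (g : E → E →L[ℝ] E →L[ℝ] ℝ) (y v w : E) (a : ℝ) :
    christoffel g y (a • v) w = a • christoffel g y v w := by
  unfold christoffel
  rw [← map_smul]
  congr 1
  ext z
  simp only [christoffelFirst_apply, smul_apply, map_smul, smul_eq_mul]
  ring

theorem christoffel_add_right (g : E → E →L[ℝ] E →L[ℝ] ℝ) (y v w w' : E) :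
    christoffel g y v (w + w') = christoffel g y v w + christoffel g y v w' := by
  unfold christoffel
  rw [← map_add]
  congr 1
  ext z
  simp only [christoffelFirst_apply, add_apply, map_add]
  ring

theorem christoffel_smul_right (g : E → E →L[ℝ] E →L[ℝ] ℝ) (y v w : E) (a : ℝ) :
    christoffel g y v (a • w) = a • christoffel g y v w := by
  unfold christoffel
  rw [← map_smul]
  congr 1
  ext z
  simp only [christoffelFirst_apply, smul_apply, map_smul, smul_eq_mul]
  ring

/-- `ContinuousLinearMap.inverse` is zero off the invertible maps, so nondegeneracy is needed here,
unlike in the linearity rules above. -/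
theorem apply_christoffel {g : E → E →L[ℝ] E →L[ℝ] ℝ} {y : E} (hg : (g y).IsInvertible)
    (v w : E) : g y (christoffel g y v w) = christoffelFirst g y v w := by
  obtain ⟨e, he⟩ := hg
  unfold christoffel
  rw [← he, ContinuousLinearMap.inverse_equiv]
  exact e.apply_symm_apply _

theorem fderiv_metric_symm {g : E → E →L[ℝ] E →L[ℝ] ℝ} {y : E} (hd : DifferentiableAt ℝ g y)
    (hs : ∀ x v w, g x v w = g x w v) (u v w : E) : fderiv ℝ g y u v w = fderiv ℝ g y u w v := by
  have h : ∀ a b : E, fderiv ℝ (fun x => g x a b) y u = fderiv ℝ g y u a b := fun a b => by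
    rw [fderiv_clm_apply (hd.clm_apply (differentiableAt_const a)) (differentiableAt_const b),
      fderiv_clm_apply hd (differentiableAt_const a)]
    simp
  rw [← h v w, ← h w v]
  simp only [hs _ v w]

/-- The Levi-Civita connection is compatible with the metric. -/
theorem christoffel_metric {g : E → E →L[ℝ] E →L[ℝ] ℝ} {y : E} (hd : DifferentiableAt ℝ g y)
    (hs : ∀ x v w, g x v w = g x w v) (hg : (g y).IsInvertible) (u v w : E) :
    g y (christoffel g y u v) w + g y v (christoffel g y u w) = fderiv ℝ g y u v w := by
  rw [hs y v, apply_christoffel hg, apply_christoffel hg, christoffelFirst_apply,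
    christoffelFirst_apply, fderiv_metric_symm hd hs u w v, fderiv_metric_symm hd hs v u w]
  ring

set_option maxSynthPendingDepth 3 in
-- In the product rule, the term from the moving base point is split between the two Christoffel
-- corrections by `christoffel_metric`.
theorem hasDerivAt_metric_apply {g : E → E →L[ℝ] E →L[ℝ] ℝ} {γ v w : ℝ → E} {u v' w' : E} {t : ℝ}
    (hd : DifferentiableAt ℝ g (γ t)) (hs : ∀ x v w, g x v w = g x w v)
    (hg : (g (γ t)).IsInvertible) (hγ : HasDerivAt γ u t) (hv : HasDerivAt v v' t)
    (hw : HasDerivAt w w' t) :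
    HasDerivAt (fun s => g (γ s) (v s) (w s))
      (g (γ t) (v' + christoffel g (γ t) u (v t)) (w t) +
        g (γ t) (v t) (w' + christoffel g (γ t) u (w t))) t := by
  have hgγ : HasDerivAt (fun s => g (γ s)) (fderiv ℝ g (γ t) u) t :=
    HasFDerivAt.comp_hasDerivAt t (f := γ) hd.hasFDerivAt hγ
  refine ((hgγ.clm_apply hv).clm_apply hw).congr_deriv ?_
  rw [map_add, map_add, add_apply, add_apply]
  linear_combination -christoffel_metric hd hs hg u (v t) (w t)

set_option maxSynthPendingDepth 3 in
-- Makes `fderiv` additive on Christoffel symbols, which linearity of the curvature in its first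
-- argument requires.
theorem differentiableAt_christoffel [CompleteSpace E] {g : E → E →L[ℝ] E →L[ℝ] ℝ} {y : E}
    (hd : ContDiffAt ℝ ∞ g y) (hg : (g y).IsInvertible) (v w : E) :
    DifferentiableAt ℝ (fun x => christoffel g x v w) y := by
  have h1 : DifferentiableAt ℝ (fderiv ℝ g : E → E →L[ℝ] E →L[ℝ] E →L[ℝ] ℝ) y := by
    have h0 : ContDiffAt ℝ 1 (fderiv ℝ g) y := hd.fderiv_right (by norm_cast)
    exact h0.differentiableAt one_ne_zero
  have h2 : ∀ a b : E, DifferentiableAt ℝ (fun x => fderiv ℝ g x a b) y := fun a b =>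
    (h1.clm_apply (differentiableAt_const a)).clm_apply (differentiableAt_const b)
  have h3 : DifferentiableAt ℝ (fun x => ((fderiv ℝ g x).flip v).flip w) y := by
    have : DifferentiableAt ℝ (fun x => (ContinuousLinearMap.flipₗᵢ ℝ E E (E →L[ℝ] ℝ))
        (fderiv ℝ g x)) y :=
      (LinearIsometryEquiv.differentiableAt _).comp y h1
    have h4 : DifferentiableAt ℝ (fun x => (fderiv ℝ g x).flip v) y :=
      this.clm_apply (differentiableAt_const v)
    exact ((LinearIsometryEquiv.differentiableAt
      (ContinuousLinearMap.flipₗᵢ ℝ E E ℝ)).comp y h4).clm_apply (differentiableAt_const w)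
  have h5 : DifferentiableAt ℝ (fun x => christoffelFirst g x v w) y :=
    (((h2 v w).add (h2 w v)).sub h3).const_smul (1 / 2 : ℝ)
  have h6 : DifferentiableAt ℝ (fun x => (g x).inverse) y :=
    ((hg.contDiffAt_map_inverse (n := 1)).differentiableAt (by simp)).comp y
      (hd.differentiableAt (by simp))
  exact h6.clm_apply h5

theorem coordCurvature_add [CompleteSpace E] {g : E → E →L[ℝ] E →L[ℝ] ℝ} {y : E}
    (hd : ContDiffAt ℝ ∞ g y) (hg : (g y).IsInvertible) (v v' w z : E) :
    coordCurvature g y (v + v') w z = coordCurvature g y v w z + coordCurvature g y v' w z := by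
  have h : fderiv ℝ (fun x => christoffel g x (v + v') z) y =
      fderiv ℝ (fun x => christoffel g x v z) y + fderiv ℝ (fun x => christoffel g x v' z) y := by
    simp only [christoffel_add_left]
    exact fderiv_fun_add (differentiableAt_christoffel hd hg v z)
      (differentiableAt_christoffel hd hg v' z)
  unfold coordCurvature
  rw [h, map_add, christoffel_add_left, christoffel_add_left, christoffel_add_right,
    add_apply]
  abel

theorem coordCurvature_smul [CompleteSpace E] {g : E → E →L[ℝ] E →L[ℝ] ℝ} {y : E}
    (hd : ContDiffAt ℝ ∞ g y) (hg : (g y).IsInvertible) (v w z : E) (a : ℝ) :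
    coordCurvature g y (a • v) w z = a • coordCurvature g y v w z := by
  have h : fderiv ℝ (fun x => christoffel g x (a • v) z) y =
      a • fderiv ℝ (fun x => christoffel g x v z) y := by
    simp only [christoffel_smul_left]
    exact fderiv_fun_const_smul (differentiableAt_christoffel hd hg v z) a
  unfold coordCurvature
  rw [h, map_smul, christoffel_smul_left, christoffel_smul_left, christoffel_smul_right,
    smul_apply]
  simp only [smul_sub, smul_add]

end Coordinates

theorem _root_.contDiffAt_clm_apply_of_forall {𝕜 D E F : Type*} [NontriviallyNormedField 𝕜]
    [CompleteSpace 𝕜] [NormedAddCommGroup D] [NormedSpace 𝕜 D] [NormedAddCommGroup E]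
    [NormedSpace 𝕜 E] [NormedAddCommGroup F] [NormedSpace 𝕜 F] [FiniteDimensional 𝕜 E]
    {n : WithTop ℕ∞} {f : D → E →L[𝕜] F} {x : D} (h : ∀ v, ContDiffAt 𝕜 n (fun y => f y v) x) :
    ContDiffAt 𝕜 n f x := by
  let d := Module.finrank 𝕜 E
  have hd : d = Module.finrank 𝕜 (Fin d → 𝕜) := (Module.finrank_fin_fun 𝕜).symm
  let e₁ := ContinuousLinearEquiv.ofFinrankEq hd
  let e₂ := (e₁.arrowCongr (1 : F ≃L[𝕜] F)).trans (ContinuousLinearEquiv.piRing (Fin d))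
  rw [← Function.id_comp f, ← e₂.symm_comp_self]
  exact e₂.symm.contDiff.contDiffAt.comp x (contDiffAt_pi.2 fun i => h _)

/-! ### The metric in preferred charts -/

section Manifold

open Bundle

variable {E : Type*} [NormedAddCommGroup E] [NormedSpace ℝ E]
  {M : Type*} [TopologicalSpace M] [ChartedSpace E M]

theorem hasDerivAt_extChartAt_comp {c : ℝ → M} {t : ℝ}
    (hc : MDifferentiableAt 𝓘(ℝ, ℝ) 𝓘(ℝ, E) c t) :
    HasDerivAt (fun s => extChartAt 𝓘(ℝ, E) (c t) (c s)) (velocity (E := E) c t : E) t := by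
  have h := hc.hasMFDerivAt.2
  obtain ⟨L, hL⟩ : ∃ L : ℝ →L[ℝ] E, L = mfderiv 𝓘(ℝ, ℝ) 𝓘(ℝ, E) c t := ⟨_, rfl⟩
  rw [← hL] at h
  have h' : HasFDerivAt (fun s => extChartAt 𝓘(ℝ, E) (c t) (c s)) L t :=
    (h.mono fun s _ => ⟨s, rfl⟩).hasFDerivAt Filter.univ_mem
  have h2 : (velocity (E := E) c t : E) = L 1 := congrArg (fun l : ℝ →L[ℝ] E => l 1) hL.symm
  rw [h2]
  exact h'.hasDerivAt

variable [IsManifold 𝓘(ℝ, E) ∞ M]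

theorem IsSmoothAlong.differentiableAt {c : ℝ → M} {V : ∀ t, TangentSpace 𝓘(ℝ, E) (c t)}
    (hV : IsSmoothAlong c V) (t : ℝ) :
    DifferentiableAt ℝ
      (fun s => (tangentCoordChange 𝓘(ℝ, E) (c s) (c t) (c s) (V s) : E)) t := by
  have h := (contMDiffAt_totalSpace.1 (hV t)).2
  have h2 : ContDiffAt ℝ ∞
      (fun s => (tangentCoordChange 𝓘(ℝ, E) (c s) (c t) (c s) (V s) : E)) t :=
    contMDiffAt_iff_contDiffAt.1 h
  exact h2.differentiableAt (by simp)

theorem IsSmoothAlong.contMDiff {c : ℝ → M} {V : ∀ t, TangentSpace 𝓘(ℝ, E) (c t)}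
    (hV : IsSmoothAlong c V) : ContMDiff 𝓘(ℝ, ℝ) 𝓘(ℝ, E) ∞ c :=
  fun t => (contMDiffAt_totalSpace.1 (hV t)).1

/-- The velocity is the tangent map of `c` applied to the constant section 1 of the tangent bundle
of ℝ. -/
theorem isSmoothAlong_velocity {c : ℝ → M} (hc : ContMDiff 𝓘(ℝ, ℝ) 𝓘(ℝ, E) ∞ c) :
    IsSmoothAlong (E := E) c (velocity c) := by
  have h := hc.contMDiff_tangentMap (m := ∞) (by simp)
  have h1 : ContMDiff 𝓘(ℝ, ℝ) 𝓘(ℝ, ℝ).tangent ∞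
      (fun t : ℝ => (⟨t, (1 : ℝ)⟩ : TangentBundle 𝓘(ℝ, ℝ) ℝ)) := by
    intro t
    rw [contMDiffAt_totalSpace]
    refine ⟨contMDiffAt_id, ?_⟩
    simpa using contMDiffAt_const
  exact h.comp h1

variable [RiemannianBundle (fun x : M => TangentSpace 𝓘(ℝ, E) x)]

theorem chartMetric_apply (p : M) (y v w : E) :
    chartMetric p y v w = @inner ℝ (TangentSpace 𝓘(ℝ, E) ((extChartAt 𝓘(ℝ, E) p).symm y)) _
      (tangentCoordChange 𝓘(ℝ, E) p ((extChartAt 𝓘(ℝ, E) p).symm y)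
        ((extChartAt 𝓘(ℝ, E) p).symm y) v)
      (tangentCoordChange 𝓘(ℝ, E) p ((extChartAt 𝓘(ℝ, E) p).symm y)
        ((extChartAt 𝓘(ℝ, E) p).symm y) w) :=
  rfl

theorem chartMetric_symm (p : M) (y v w : E) : chartMetric p y v w = chartMetric p y w v := by
  rw [chartMetric_apply, chartMetric_apply]
  exact @real_inner_comm (TangentSpace 𝓘(ℝ, E) ((extChartAt 𝓘(ℝ, E) p).symm y)) _ _ _ _

theorem chartMetric_extChartAt {p q : M} (hq : q ∈ (extChartAt 𝓘(ℝ, E) p).source) (v w : E) :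
    chartMetric p (extChartAt 𝓘(ℝ, E) p q) (tangentCoordChange 𝓘(ℝ, E) q p q v)
      (tangentCoordChange 𝓘(ℝ, E) q p q w) = @inner ℝ (TangentSpace 𝓘(ℝ, E) q) _ v w := by
  have h : ∀ u : E, tangentCoordChange 𝓘(ℝ, E) p q q (tangentCoordChange 𝓘(ℝ, E) q p q u) = u :=
    fun u => by
      rw [tangentCoordChange_comp ⟨⟨mem_extChartAt_source q, hq⟩, mem_extChartAt_source q⟩,
        tangentCoordChange_self (mem_extChartAt_source q)]
  rw [chartMetric_apply, (extChartAt 𝓘(ℝ, E) p).left_inv hq, h, h]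

theorem chartMetric_self (p : M) (v w : E) :
    chartMetric p (extChartAt 𝓘(ℝ, E) p p) v w = @inner ℝ (TangentSpace 𝓘(ℝ, E) p) _ v w := by
  have h := chartMetric_extChartAt (mem_extChartAt_source (I := 𝓘(ℝ, E)) p) v w
  rwa [tangentCoordChange_self (mem_extChartAt_source p),
    tangentCoordChange_self (mem_extChartAt_source p)] at h

/-- Positive definiteness gives injectivity into the dual, which has the same finite dimension. -/
theorem isInvertible_chartMetric [FiniteDimensional ℝ E] (p : M) :
    (chartMetric p (extChartAt 𝓘(ℝ, E) p p)).IsInvertible := by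
  have hinj : Function.Injective (chartMetric p (extChartAt 𝓘(ℝ, E) p p)) := by
    rw [injective_iff_map_eq_zero]
    intro v hv
    have h1 := chartMetric_self p v v
    rw [hv] at h1
    exact (@inner_self_eq_zero ℝ (TangentSpace 𝓘(ℝ, E) p) _ _ _ v).1 h1.symm
  have hrank : Module.finrank ℝ E = Module.finrank ℝ (E →L[ℝ] ℝ) := by
    rw [← (LinearMap.toContinuousLinearMap (𝕜 := ℝ) (E := E) (F' := ℝ)).finrank_eq]
    exact Subspace.dual_finrank_eq.symm
  refine ⟨(LinearEquiv.ofInjectiveOfFinrankEq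
    (chartMetric p (extChartAt 𝓘(ℝ, E) p p)).toLinearMap hinj hrank).toContinuousLinearEquiv, ?_⟩
  ext v w
  rfl

variable [IsContMDiffRiemannianBundle 𝓘(ℝ, E) ∞ E (fun x : M => TangentSpace 𝓘(ℝ, E) x)]

/-- It suffices to test on fixed `v`, `w`: fields with constant coordinates in the chart are smooth
near the point, and so is their inner product. -/
theorem contDiffAt_chartMetric [FiniteDimensional ℝ E] (p : M) :
    ContDiffAt ℝ ∞ (chartMetric p) (extChartAt 𝓘(ℝ, E) p p) := by
  have htarget : (extChartAt 𝓘(ℝ, E) p).target ∈ nhds (extChartAt 𝓘(ℝ, E) p p) :=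
    extChartAt_target_mem_nhds p
  have hsec : ∀ v : E, ContMDiffAt 𝓘(ℝ, E) 𝓘(ℝ, E).tangent ∞
      (fun y => (⟨(extChartAt 𝓘(ℝ, E) p).symm y,
        tangentCoordChange 𝓘(ℝ, E) p ((extChartAt 𝓘(ℝ, E) p).symm y)
          ((extChartAt 𝓘(ℝ, E) p).symm y) v⟩ : TangentBundle 𝓘(ℝ, E) M))
      (extChartAt 𝓘(ℝ, E) p p) := by
    intro v
    rw [contMDiffAt_totalSpace]
    refine ⟨(contMDiffOn_extChartAt_symm p).contMDiffAt htarget, ?_⟩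
    refine (contMDiffAt_const (c := v)).congr_of_eventuallyEq ?_
    filter_upwards [htarget] with y hy
    have hq := (extChartAt 𝓘(ℝ, E) p).map_target hy
    rw [extChartAt_to_inv]
    change tangentCoordChange 𝓘(ℝ, E) _ p _ (tangentCoordChange 𝓘(ℝ, E) p _ _ v) = v
    rw [tangentCoordChange_comp ⟨⟨hq, mem_extChartAt_source _⟩, hq⟩, tangentCoordChange_self hq]
  refine contDiffAt_clm_apply_of_forall fun v => contDiffAt_clm_apply_of_forall fun w => ?_
  exact contMDiffAt_iff_contDiffAt.1 (ContMDiffAt.inner_bundle (F := E)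
    (E := fun x : M => TangentSpace 𝓘(ℝ, E) x) (hsec v) (hsec w))

end Manifold

end HarmonicManifold

namespace HarmonicManifold

/-! ### Covariant derivatives and parallel fields along curves -/

section AlongCurves

open Bundle

variable {E : Type*} [NormedAddCommGroup E] [NormedSpace ℝ E]
  {M : Type*} [TopologicalSpace M] [ChartedSpace E M]

theorem velocity_comp_add_const {c : ℝ → M} (hc : MDifferentiable 𝓘(ℝ, ℝ) 𝓘(ℝ, E) c) (s t : ℝ) :
    (velocity (E := E) (fun t => c (t + s)) t : E) = velocity (E := E) c (t + s) := by
  have hs : MDifferentiable 𝓘(ℝ, ℝ) 𝓘(ℝ, E) (fun t => c (t + s)) :=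
    hc.comp (differentiable_id.add_const s).mdifferentiable
  exact (hasDerivAt_extChartAt_comp (hs t)).unique
    ((hasDerivAt_extChartAt_comp (hc (t + s))).comp_add_const t s)

variable [IsManifold 𝓘(ℝ, E) ∞ M]

theorem IsSmoothAlong.comp_add_const {c : ℝ → M} {V : ∀ t, TangentSpace 𝓘(ℝ, E) (c t)}
    (hV : IsSmoothAlong c V) (s : ℝ) :
    IsSmoothAlong (fun t => c (t + s)) (fun t => V (t + s)) :=
  ContMDiff.comp hV (contDiff_id.add contDiff_const).contMDiff

variable [RiemannianBundle (fun x : M => TangentSpace 𝓘(ℝ, E) x)]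

theorem covDeriv_comp_add_const {c : ℝ → M} (hc : MDifferentiable 𝓘(ℝ, ℝ) 𝓘(ℝ, E) c)
    (V : ∀ t, TangentSpace 𝓘(ℝ, E) (c t)) (s t : ℝ) :
    (covDeriv (fun t => c (t + s)) (fun t => V (t + s)) t : E) = covDeriv c V (t + s) := by
  unfold covDeriv
  rw [velocity_comp_add_const hc]
  exact congrArg (fun x : E => x + christoffel (chartMetric (c (t + s)))
    (extChartAt 𝓘(ℝ, E) (c (t + s)) (c (t + s))) (velocity c (t + s)) (V (t + s)))
    (deriv_comp_add_const (f := fun r =>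
      (tangentCoordChange 𝓘(ℝ, E) (c r) (c (t + s)) (c r) (V r) : E)) s t)

theorem IsParallelAlong.comp_add_const {c : ℝ → M} {V : ∀ t, TangentSpace 𝓘(ℝ, E) (c t)}
    (hV : IsParallelAlong c V) (s : ℝ) :
    IsParallelAlong (fun t => c (t + s)) (fun t => V (t + s)) :=
  ⟨hV.1.comp_add_const s, fun t =>
    (covDeriv_comp_add_const (hV.1.contMDiff.mdifferentiable (by simp)) V s t).trans (hV.2 (t + s))⟩

theorem IsUnitSpeedGeodesic.comp_add_const {c : ℝ → M} (hc : IsUnitSpeedGeodesic E c) (s : ℝ) :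
    IsUnitSpeedGeodesic E (fun t => c (t + s)) := by
  have hd : MDifferentiable 𝓘(ℝ, ℝ) 𝓘(ℝ, E) c := hc.1.1.mdifferentiable (by simp)
  have hv : velocity (E := E) (fun t => c (t + s)) = fun t => velocity (E := E) c (t + s) :=
    funext fun t => velocity_comp_add_const hd s t
  refine ⟨⟨hc.1.1.comp (contDiff_id.add contDiff_const).contMDiff, fun t => ?_⟩, fun t => ?_⟩
  · rw [hv]
    exact (covDeriv_comp_add_const hd (velocity c) s t).trans (hc.1.2 (t + s))
  · rw [hv]
    exact hc.2 (t + s)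

/-- The Leibniz rule for linear combinations of parallel fields. -/
theorem covDeriv_sum_smul {ι : Type*} [Fintype ι] {c : ℝ → M}
    {e : ι → ∀ t, TangentSpace 𝓘(ℝ, E) (c t)} (he : ∀ i, IsParallelAlong c (e i))
    {y : ι → ℝ → ℝ} {t : ℝ} (hy : ∀ i, DifferentiableAt ℝ (y i) t) :
    covDeriv c (fun s => ∑ i, y i s • e i s) t = ∑ i, deriv (y i) t • e i t := by
  let Γ : E →ₗ[ℝ] E :=
    { toFun := fun w => christoffel (chartMetric (c t)) (extChartAt 𝓘(ℝ, E) (c t) (c t))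
        (velocity c t) w
      map_add' := fun w w' => christoffel_add_right _ _ _ _ _
      map_smul' := fun a w => christoffel_smul_right _ _ _ _ _ }
  let ε : ι → E := fun i => e i t
  let w : ι → ℝ → E := fun i s => tangentCoordChange 𝓘(ℝ, E) (c s) (c t) (c s) (e i s)
  have hw : ∀ i, deriv (w i) t + Γ (ε i) = 0 := fun i => (he i).2 t
  have hwt : ∀ i, w i t = ε i := fun i => tangentCoordChange_self (mem_extChartAt_source (c t))
  have hsum : (fun s => tangentCoordChange 𝓘(ℝ, E) (c s) (c t) (c s) (∑ i, y i s • e i s : E)) =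
      fun s => ∑ i, y i s • w i s := by
    funext s
    exact (map_sum _ _ _).trans (Finset.sum_congr rfl fun i _ => map_smul _ _ _)
  have hder : deriv (fun s => ∑ i, y i s • w i s) t =
      ∑ i, (y i t • deriv (w i) t + deriv (y i) t • w i t) := by
    refine (HasDerivAt.fun_sum fun i _ => ?_).deriv
    exact (hy i).hasDerivAt.smul ((he i).1.differentiableAt t).hasDerivAt
  change (deriv (fun s => (tangentCoordChange 𝓘(ℝ, E) (c s) (c t) (c s)
    (∑ i, y i s • e i s : E) : E)) t + Γ (∑ i, y i t • ε i) : E) =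
      ∑ i, deriv (y i) t • ε i
  rw [hsum, hder, map_sum, ← Finset.sum_add_distrib]
  refine Finset.sum_congr rfl fun i _ => ?_
  rw [Γ.map_smul, hwt, add_right_comm, ← smul_add, hw, smul_zero, zero_add]

variable [IsContMDiffRiemannianBundle 𝓘(ℝ, E) ∞ E (fun x : M => TangentSpace 𝓘(ℝ, E) x)]

theorem IsSmoothAlong.contDiff_inner {c : ℝ → M} {V W : ∀ t, TangentSpace 𝓘(ℝ, E) (c t)}
    (hV : IsSmoothAlong c V) (hW : IsSmoothAlong c W) :
    ContDiff ℝ ∞ fun t => @inner ℝ (TangentSpace 𝓘(ℝ, E) (c t)) _ (V t) (W t) :=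
  contMDiff_iff_contDiff.1 (ContMDiff.inner_bundle (F := E)
    (E := fun x : M => TangentSpace 𝓘(ℝ, E) x) hV hW)

variable [FiniteDimensional ℝ E]

theorem hasDerivAt_inner {c : ℝ → M} {V W : ∀ t, TangentSpace 𝓘(ℝ, E) (c t)}
    (hV : IsSmoothAlong c V) (hW : IsSmoothAlong c W) (t : ℝ) :
    HasDerivAt (fun t => @inner ℝ (TangentSpace 𝓘(ℝ, E) (c t)) _ (V t) (W t))
      (@inner ℝ (TangentSpace 𝓘(ℝ, E) (c t)) _ (covDeriv c V t) (W t) +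
        @inner ℝ (TangentSpace 𝓘(ℝ, E) (c t)) _ (V t) (covDeriv c W t)) t := by
  have hvt : tangentCoordChange 𝓘(ℝ, E) (c t) (c t) (c t) (V t) = V t :=
    tangentCoordChange_self (mem_extChartAt_source (c t))
  have hwt : tangentCoordChange 𝓘(ℝ, E) (c t) (c t) (c t) (W t) = W t :=
    tangentCoordChange_self (mem_extChartAt_source (c t))
  have hγ := hasDerivAt_extChartAt_comp (hV.contMDiff.mdifferentiable (by simp) t)
  have h := hasDerivAt_metric_apply (g := chartMetric (c t)) (t := t)
    (γ := fun s => extChartAt 𝓘(ℝ, E) (c t) (c s))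
    (v := fun s => tangentCoordChange 𝓘(ℝ, E) (c s) (c t) (c s) (V s))
    (w := fun s => tangentCoordChange 𝓘(ℝ, E) (c s) (c t) (c s) (W s))
    ((contDiffAt_chartMetric (c t)).differentiableAt (by simp)) (chartMetric_symm (c t))
    (isInvertible_chartMetric (c t))
    hγ
    (hV.differentiableAt t).hasDerivAt (hW.differentiableAt t).hasDerivAt
  -- For `s` near `t` the inner product is computed in the one fixed chart at `c t`.
  have hev : (fun s => @inner ℝ (TangentSpace 𝓘(ℝ, E) (c s)) _ (V s) (W s)) =ᶠ[nhds t]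
      fun s => chartMetric (c t) (extChartAt 𝓘(ℝ, E) (c t) (c s))
        (tangentCoordChange 𝓘(ℝ, E) (c s) (c t) (c s) (V s))
        (tangentCoordChange 𝓘(ℝ, E) (c s) (c t) (c s) (W s)) := by
    filter_upwards [hV.contMDiff.continuous.continuousAt.preimage_mem_nhds
      (extChartAt_source_mem_nhds (I := 𝓘(ℝ, E)) (c t))] with s hs
    exact (chartMetric_extChartAt hs _ _).symm
  have h1 := h.congr_of_eventuallyEq hev
  beta_reduce at h1
  rw [hvt, hwt] at h1
  have e1 := chartMetric_self (E := E) (c t) (covDeriv c V t) (W t)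
  have e2 := chartMetric_self (E := E) (c t) (V t) (covDeriv c W t)
  rw [← e1, ← e2]
  exact h1

theorem inner_parallel_eq {c : ℝ → M} {V W : ∀ t, TangentSpace 𝓘(ℝ, E) (c t)}
    (hV : IsParallelAlong c V) (hW : IsParallelAlong c W) (t t' : ℝ) :
    @inner ℝ (TangentSpace 𝓘(ℝ, E) (c t)) _ (V t) (W t) =
      @inner ℝ (TangentSpace 𝓘(ℝ, E) (c t')) _ (V t') (W t') := by
  have h : ∀ t, HasDerivAt (fun t => @inner ℝ (TangentSpace 𝓘(ℝ, E) (c t)) _ (V t) (W t)) 0 t := by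
    intro t
    refine (hasDerivAt_inner hV.1 hW.1 t).congr_deriv ?_
    rw [hV.2, hW.2, inner_zero_left, inner_zero_right, add_zero]
  exact is_const_of_deriv_eq_zero (fun t => (h t).differentiableAt) (fun t => (h t).deriv) t t'

/-- The velocity of a geodesic is parallel, so its length is constant. -/
theorem IsGeodesic.isUnitSpeedGeodesic {c : ℝ → M} (hc : IsGeodesic E c) {t₀ : ℝ}
    (h : ‖(velocity c t₀ : TangentSpace 𝓘(ℝ, E) (c t₀))‖ = 1) : IsUnitSpeedGeodesic E c := by
  refine ⟨hc, fun t => ?_⟩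
  have hp : IsParallelAlong c (velocity (E := E) c) := ⟨isSmoothAlong_velocity hc.1, hc.2⟩
  have h1 := inner_parallel_eq hp hp t t₀
  rw [real_inner_self_eq_norm_sq, real_inner_self_eq_norm_sq, h] at h1
  exact (sq_eq_sq₀ (norm_nonneg _) zero_le_one).1 h1

theorem curvature_sum_smul {ι : Type*} [Fintype ι] (p : M) (a : ι → ℝ)
    (v : ι → TangentSpace 𝓘(ℝ, E) p) (w z : TangentSpace 𝓘(ℝ, E) p) :
    curvature p (∑ i, a i • v i) w z = ∑ i, a i • curvature p (v i) w z := by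
  let R : E →ₗ[ℝ] E :=
    { toFun := fun v => coordCurvature (chartMetric p) (extChartAt 𝓘(ℝ, E) p p) v w z
      map_add' := fun v v' =>
        coordCurvature_add (contDiffAt_chartMetric p) (isInvertible_chartMetric p) v v' w z
      map_smul' := fun a v =>
        coordCurvature_smul (contDiffAt_chartMetric p) (isInvertible_chartMetric p) v w z a }
  have h : ∀ v : ι → E, R (∑ i, a i • v i) = ∑ i, a i • R (v i) := fun v => by
    simp only [map_sum, map_smul]
  exact h v

end AlongCurves

end HarmonicManifold

namespace HarmonicManifold

/-! ### Jacobi tensors in parallel normal frames -/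

section JacobiTensors

open Bundle

variable {E : Type*} [NormedAddCommGroup E] [NormedSpace ℝ E]
  {M : Type*} [TopologicalSpace M] [ChartedSpace E M] [IsManifold 𝓘(ℝ, E) ∞ M]
  [RiemannianBundle (fun x : M => TangentSpace 𝓘(ℝ, E) x)]

theorem coe_mem_normalSpace_comp_add_const {c : ℝ → M} (hc : IsUnitSpeedGeodesic E c) (s t : ℝ)
    (v : normalSpace E c (t + s)) :
    (v : TangentSpace 𝓘(ℝ, E) (c (t + s))) ∈ normalSpace E (fun t => c (t + s)) t := by
  have hv : velocity (E := E) (fun t => c (t + s)) t = velocity (E := E) c (t + s) :=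
    velocity_comp_add_const (hc.1.1.mdifferentiable (by simp)) s t
  unfold normalSpace
  rw [hv]
  exact v.2

/-- The matrix of the curvature endomorphism `w ↦ R(w, ċ) ċ` in a frame of the normal bundle. -/
noncomputable def frameCurvature (c : ℝ → M) (e : Fin (Module.finrank ℝ E - 1) → ∀ t, normalSpace E c t) (t : ℝ) :
    Matrix (Fin (Module.finrank ℝ E - 1)) (Fin (Module.finrank ℝ E - 1)) ℝ :=
  Matrix.of fun j k => @inner ℝ (TangentSpace 𝓘(ℝ, E) (c t)) _
    (curvature (E := E) (c t) (e k t) (velocity c t) (velocity c t)) (e j t)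

theorem IsParallelNormalFrame.comp_add_const {c : ℝ → M} (hc : IsUnitSpeedGeodesic E c)
    {e : Fin (Module.finrank ℝ E - 1) → ∀ t, normalSpace E c t} (he : IsParallelNormalFrame c e)
    (s : ℝ) :
    IsParallelNormalFrame (fun t => c (t + s)) fun i t =>
      ⟨e i (t + s), coe_mem_normalSpace_comp_add_const hc s t (e i (t + s))⟩ := by
  refine ⟨fun t => ?_, fun i => (he.2 i).comp_add_const s⟩
  rw [orthonormal_iff_ite]
  exact orthonormal_iff_ite.1 (he.1 (t + s))

theorem frameCurvature_comp_add_const {c : ℝ → M} (hc : IsUnitSpeedGeodesic E c)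
    (e : Fin (Module.finrank ℝ E - 1) → ∀ t, normalSpace E c t) (s t : ℝ) :
    frameCurvature (fun t => c (t + s))
      (fun i t => ⟨e i (t + s), coe_mem_normalSpace_comp_add_const hc s t (e i (t + s))⟩) t =
        frameCurvature c e (t + s) := by
  have hv : velocity (E := E) (fun t => c (t + s)) t = velocity (E := E) c (t + s) :=
    velocity_comp_add_const (hc.1.1.mdifferentiable (by simp)) s t
  unfold frameCurvature
  rw [hv]

variable [FiniteDimensional ℝ E]

instance finiteDimensional_tangentSpace (p : M) : FiniteDimensional ℝ (TangentSpace 𝓘(ℝ, E) p) :=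
  inferInstanceAs (FiniteDimensional ℝ E)

instance finiteDimensional_normalSpace (c : ℝ → M) (t : ℝ) :
    FiniteDimensional ℝ (normalSpace E c t) :=
  FiniteDimensional.finiteDimensional_submodule _

theorem finrank_normalSpace {c : ℝ → M} (hc : IsUnitSpeedGeodesic E c) (t : ℝ) :
    Module.finrank ℝ (normalSpace E c t) = Module.finrank ℝ E - 1 := by
  have hv : (velocity c t : TangentSpace 𝓘(ℝ, E) (c t)) ≠ 0 := fun h => by
    simpa [h] using hc.2 t
  have h := (Submodule.span ℝ
    {(velocity c t : TangentSpace 𝓘(ℝ, E) (c t))}).finrank_add_finrank_orthogonal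
  rw [finrank_span_singleton hv] at h
  have h2 : Module.finrank ℝ (TangentSpace 𝓘(ℝ, E) (c t)) = Module.finrank ℝ E := rfl
  unfold normalSpace
  omega

/-- A normal orthonormal frame as an orthonormal basis of the fibre at time `t`. -/
noncomputable def normalBasis {c : ℝ → M} (hc : IsUnitSpeedGeodesic E c) (t : ℝ)
    (e : Fin (Module.finrank ℝ E - 1) → normalSpace E c t) (he : Orthonormal ℝ e) :
    OrthonormalBasis (Fin (Module.finrank ℝ E - 1)) ℝ (normalSpace E c t) :=
  OrthonormalBasis.mk he (he.linearIndependent.span_eq_top_of_card_eq_finrank'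
    (by rw [finrank_normalSpace hc, Fintype.card_fin])).ge

theorem normalBasis_apply {c : ℝ → M} (hc : IsUnitSpeedGeodesic E c) (t : ℝ)
    (e : Fin (Module.finrank ℝ E - 1) → normalSpace E c t) (he : Orthonormal ℝ e)
    (i : Fin (Module.finrank ℝ E - 1)) : normalBasis hc t e he i = e i := by
  simp [normalBasis]

theorem eq_sum_inner_smul {c : ℝ → M} (hc : IsUnitSpeedGeodesic E c) (t : ℝ)
    (e : Fin (Module.finrank ℝ E - 1) → normalSpace E c t) (he : Orthonormal ℝ e)
    (v : normalSpace E c t) :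
    (v : TangentSpace 𝓘(ℝ, E) (c t)) =
      ∑ i, @inner ℝ (TangentSpace 𝓘(ℝ, E) (c t)) _ v (e i) •
        (e i : TangentSpace 𝓘(ℝ, E) (c t)) := by
  have h := congrArg (fun w : normalSpace E c t => (w : TangentSpace 𝓘(ℝ, E) (c t)))
    ((normalBasis hc t e he).sum_repr' v)
  refine h.symm.trans ?_
  simp only [Submodule.coe_sum, Submodule.coe_smul, normalBasis_apply, Submodule.coe_inner]
  exact Finset.sum_congr rfl fun i _ => by rw [real_inner_comm]

variable [IsContMDiffRiemannianBundle 𝓘(ℝ, E) ∞ E (fun x : M => TangentSpace 𝓘(ℝ, E) x)]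

/-- The components of a normal Jacobi field in a parallel normal frame solve a linear equation. -/
theorem IsJacobiField.deriv_deriv_inner {c : ℝ → M} (hc : IsUnitSpeedGeodesic E c)
    {e : Fin (Module.finrank ℝ E - 1) → ∀ t, normalSpace E c t} (he : IsParallelNormalFrame c e)
    {J : ∀ t, normalSpace E c t} (hJ : IsJacobiField c fun t => (J t : TangentSpace 𝓘(ℝ, E) (c t)))
    (j : Fin (Module.finrank ℝ E - 1)) (t : ℝ) :
    deriv (deriv fun t => @inner ℝ (TangentSpace 𝓘(ℝ, E) (c t)) _ (J t) (e j t)) t +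
      ∑ k, frameCurvature c e t j k * @inner ℝ (TangentSpace 𝓘(ℝ, E) (c t)) _ (J t) (e k t) = 0 := by
  let y : Fin (Module.finrank ℝ E - 1) → ℝ → ℝ := fun k t =>
    @inner ℝ (TangentSpace 𝓘(ℝ, E) (c t)) _ (J t) (e k t)
  have hy : ∀ k, ContDiff ℝ ∞ (y k) := fun k => hJ.1.contDiff_inner (he.2 k).1
  have hy' : ∀ k, ContDiff ℝ ∞ (deriv (y k)) := fun k => (contDiff_infty_iff_deriv.1 (hy k)).2
  have hJe : (fun t => (J t : TangentSpace 𝓘(ℝ, E) (c t))) =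
      fun t => ∑ k, y k t • (e k t : TangentSpace 𝓘(ℝ, E) (c t)) :=
    funext fun t => eq_sum_inner_smul hc t (fun k => e k t) (he.1 t) (J t)
  have hD : covDeriv c (fun t => (J t : TangentSpace 𝓘(ℝ, E) (c t))) =
      fun t => ∑ k, deriv (y k) t • (e k t : TangentSpace 𝓘(ℝ, E) (c t)) := by
    rw [hJe]
    exact funext fun t => covDeriv_sum_smul he.2 fun k => (hy k).differentiable (by simp) t
  have hDD : covDeriv c (covDeriv c fun t => (J t : TangentSpace 𝓘(ℝ, E) (c t))) t =
      ∑ k, deriv (deriv (y k)) t • (e k t : TangentSpace 𝓘(ℝ, E) (c t)) := by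
    rw [hD]
    exact covDeriv_sum_smul he.2 fun k => (hy' k).differentiable (by simp) t
  have hR : curvature (E := E) (c t) (J t) (velocity c t) (velocity c t) =
      ∑ k, y k t • curvature (E := E) (c t) (e k t) (velocity c t) (velocity c t) := by
    rw [← curvature_sum_smul]
    exact congrArg (fun v : TangentSpace 𝓘(ℝ, E) (c t) =>
      curvature (E := E) (c t) v (velocity c t) (velocity c t)) (congrFun hJe t)
  -- Pairing the Jacobi equation with `e j` extracts its `j`-th component by orthonormality.
  have h := congrArg (fun v : TangentSpace 𝓘(ℝ, E) (c t) =>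
    @inner ℝ (TangentSpace 𝓘(ℝ, E) (c t)) _ v (e j t)) (hJ.2 t)
  beta_reduce at h
  rw [hDD, hR, inner_add_left, sum_inner, sum_inner, inner_zero_left] at h
  rw [← h]
  congr 1
  · have horth : ∀ k, @inner ℝ (TangentSpace 𝓘(ℝ, E) (c t)) _ (e k t) (e j t) =
        if k = j then 1 else 0 := fun k => (orthonormal_iff_ite.1 (he.1 t)) k j
    simp only [real_inner_smul_left, horth]
    simp [y]
  · refine Finset.sum_congr rfl fun k _ => ?_
    rw [real_inner_smul_left, mul_comm]
    rfl

/-- In any parallel orthonormal frame the determinant of the Jacobi tensor is proportional to the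
determinant of a system of solutions of the Jacobi equation. -/
theorem IsJacobiTensorA.exists_det_eq {c : ℝ → M} (hc : IsUnitSpeedGeodesic E c)
    {e : Fin (Module.finrank ℝ E - 1) → ∀ t, normalSpace E c t} (he : IsParallelNormalFrame c e)
    {A : ∀ t, normalSpace E c t →ₗ[ℝ] normalSpace E c t} (hA : IsJacobiTensorA c A) :
    ∃ (κ : ℝ) (Y : ℝ → Matrix (Fin (Module.finrank ℝ E - 1)) (Fin (Module.finrank ℝ E - 1)) ℝ),
      (∀ i j, ContDiff ℝ ∞ fun t => Y t i j) ∧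
      (∀ i j t, deriv (deriv fun u => Y u i j) t + ∑ k, frameCurvature c e t j k * Y t i k = 0) ∧
      ∀ t, LinearMap.det (A t) = κ * (Y t).det := by
  obtain ⟨-, e', he', hA⟩ := hA
  let Y : ℝ → Matrix (Fin (Module.finrank ℝ E - 1)) (Fin (Module.finrank ℝ E - 1)) ℝ := fun t =>
    Matrix.of fun i j => @inner ℝ (TangentSpace 𝓘(ℝ, E) (c t)) _ (A t (e' i t)) (e j t)
  -- The frame `e'` that comes with `A` need not be `e`. Inner products of parallel fields are
  -- constant, so the change of frame `O` is constant and its determinant is the factor `κ`.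
  let O : ℝ → Matrix (Fin (Module.finrank ℝ E - 1)) (Fin (Module.finrank ℝ E - 1)) ℝ := fun t =>
    Matrix.of fun i j => @inner ℝ (TangentSpace 𝓘(ℝ, E) (c t)) _ (e' i t) (e j t)
  have hO : ∀ t, O t = O 0 := fun t => by
    ext i j
    exact inner_parallel_eq (he'.2 i) (he.2 j) t 0
  refine ⟨(O 0).det, Y, fun i j => (hA i).1.1.contDiff_inner (he.2 j).1,
    fun i j t => (hA i).1.deriv_deriv_inner hc he j t, fun t => ?_⟩
  let b := normalBasis hc t (fun i => e i t) (he.1 t)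
  let b' := normalBasis hc t (fun i => e' i t) (he'.1 t)
  have hOb : O t = b'.toBasis.toMatrix b := by
    ext i j
    rw [Module.Basis.toMatrix_apply, OrthonormalBasis.coe_toBasis_repr_apply,
      OrthonormalBasis.repr_apply_apply, normalBasis_apply, normalBasis_apply]
    rfl
  have hYb : Y t = (LinearMap.toMatrix b'.toBasis b.toBasis (A t)).transpose := by
    ext i j
    rw [Matrix.transpose_apply, LinearMap.toMatrix_apply, OrthonormalBasis.coe_toBasis_repr_apply,
      OrthonormalBasis.repr_apply_apply, OrthonormalBasis.coe_toBasis, normalBasis_apply,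
      normalBasis_apply, real_inner_comm]
    rfl
  rw [← hO t, hOb, hYb, Matrix.det_transpose, ← Matrix.det_mul,
    ← LinearMap.det_toMatrix b'.toBasis]
  congr 1
  rw [← OrthonormalBasis.coe_toBasis b, basis_toMatrix_mul_linearMap_toMatrix]

/-- One frame along `c` is fixed and its shifts are used on all curves `c(· + s)`, so that a single
coefficient `R`, evaluated at `t + s`, governs every Jacobi tensor. -/
theorem IsDensityFunction.isExponentialPolynomial_of_geodesic {f : ℝ → ℝ}
    (hf : IsDensityFunction E M f) {c : ℝ → M} (hc : IsUnitSpeedGeodesic E c) :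
    IsExponentialPolynomial f := by
  obtain ⟨-, ⟨-, e, he, -⟩, -⟩ := hf c hc
  refine isExponentialPolynomial_of_det (frameCurvature c e) f fun s => ?_
  obtain ⟨A, hA, hdet⟩ := hf _ (hc.comp_add_const s)
  obtain ⟨κ, Y, hY, hode, hκ⟩ := hA.exists_det_eq (hc.comp_add_const s) (he.comp_add_const hc s)
  refine ⟨κ, Y, hY, fun i j t => ?_, fun t => (hdet t).trans (hκ t)⟩
  rw [← hode i j t, frameCurvature_comp_add_const hc]

theorem IsGeodesicallyComplete.exists_isUnitSpeedGeodesic [Nontrivial E] [Nonempty M]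
    (h : IsGeodesicallyComplete E M) : ∃ c : ℝ → M, IsUnitSpeedGeodesic E c := by
  obtain ⟨p⟩ := ‹Nonempty M›
  have : Nontrivial (TangentSpace 𝓘(ℝ, E) p) := inferInstanceAs (Nontrivial E)
  obtain ⟨v, hv⟩ := exists_norm_eq (TangentSpace 𝓘(ℝ, E) p) zero_le_one
  obtain ⟨c, hc, hcv⟩ := h p v
  refine ⟨c, hc.isUnitSpeedGeodesic (t₀ := 0) ?_⟩
  have hn := congrArg (fun x : TangentBundle 𝓘(ℝ, E) M =>
    @norm (TangentSpace 𝓘(ℝ, E) x.proj) _ x.snd) hcv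
  exact hn.trans hv

end JacobiTensors

end HarmonicManifold

open Bundle in
theorem mainTheorem1
    {E : Type*} [NormedAddCommGroup E] [NormedSpace ℝ E] [FiniteDimensional ℝ E] [Nontrivial E]
    {M : Type*} [TopologicalSpace M] [T2Space M] [ChartedSpace E M] [IsManifold 𝓘(ℝ, E) ∞ M]
    [RiemannianBundle (fun x : M => TangentSpace 𝓘(ℝ, E) x)]
    [IsContMDiffRiemannianBundle 𝓘(ℝ, E) ∞ E (fun x : M => TangentSpace 𝓘(ℝ, E) x)]
    (hM : HarmonicManifold.IsHarmonicManifold E M)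
    (f : ℝ → ℝ) (hf : HarmonicManifold.IsDensityFunction E M f) :
    IsExponentialPolynomial f := by
  -- Simple connectedness includes nonemptiness, which provides the starting point of a geodesic.
  have := hM.simplyConnected
  obtain ⟨c, hc⟩ := hM.complete.exists_isUnitSpeedGeodesic
  exact hf.isExponentialPolynomial_of_geodesic hc
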